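/- A randomized query algorithm on $n$-bit inputs is a probability distribution over deterministic decision trees that query single coordinates of $x\in\{0,1\}^n$; it computes $f:\{0,1\}^n\to\{0,1\}$ with error $\varepsilon$ if for every $x$ it outputs $f(x)$ with probability at least $1-\varepsilon$. Let $\mathrm{R}_\varepsilon(f)$ be the least worst-case number of queries (maximum over inputs and internal randomness) of an algorithm computing $f$ with error $\varepsilon$, put $\mathrm{R}(f)=\mathrm{R}_{1/3}(f)$, and let $\overline{\mathrm{R}}_\varepsilon(f)$ be the infimum, over algorithms computing $f$ with error $\varepsilon$, of the maximum over inputs of the expected number of queries. **Theorem.** There is an absolute constant $c>0$ such that for infinitely many $n$ there is a non-constant total function $f:\{0,1\}^n\to\{0,1\}$ such that, for every $\varepsilon$ with $2^{-(n/\log_2 n)^{1/3}}<\varepsilon\le\frac13$, \[ \overline{\mathrm{R}}_\varepsilon(f)\;\ge\; c\cdot \mathrm{R}(f)\cdot\log_2\tfrac1\varepsilon . \] -/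

import Mathlib

open scoped ENNReal

/-- Deterministic query algorithms (decision trees) with output in `{0,1}`, querying coordinates
`i : ι` of an input `x : ι → X`: either halt with an output, or query a coordinate and continue
according to the symbol read. -/
inductive DecisionTree (ι X : Type) : Type
  | leaf (b : Bool) : DecisionTree ι X
  | query (i : ι) (next : X → DecisionTree ι X) : DecisionTree ι X

namespace DecisionTree

variable {ι X : Type}

/-- The output on input `x`. -/
def eval : DecisionTree ι X → (ι → X) → Bool
  | leaf b, _ => b
  | query i next, x => (next (x i)).eval x

/-- The number of queries made on input `x`. -/
def cost : DecisionTree ι X → (ι → X) → ℕ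
  | leaf _, _ => 0
  | query i next, x => (next (x i)).cost x + 1

end DecisionTree

noncomputable section

/-- A randomized query algorithm: a probability distribution over deterministic ones. -/
abbrev RandomizedAlgorithm (ι X : Type) : Type := PMF (DecisionTree ι X)

namespace RandomizedAlgorithm

variable {ι X : Type}

/-- The distribution of the output on input `x`. -/
def output (A : RandomizedAlgorithm ι X) (x : ι → X) : PMF Bool :=
  PMF.map (fun t => t.eval x) A

/-- `A` computes the total function `f` with error `ε`: on every input, the output is `f x`
with probability at least `1 - ε`. -/
def Computes (A : RandomizedAlgorithm ι X) (f : (ι → X) → Bool) (ε : ℝ) : Prop :=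
  ∀ x, 1 - ε ≤ (A.output x (f x)).toReal

/-- The query cost: the maximum number of queries, over all inputs and all outcomes of the
internal randomness. -/
def worstCost (A : RandomizedAlgorithm ι X) : ℝ≥0∞ :=
  ⨆ x : ι → X, ⨆ t ∈ A.support, (t.cost x : ℝ≥0∞)

/-- The average query cost: the maximum over all inputs of the expected number of queries. -/
def averageCost (A : RandomizedAlgorithm ι X) : ℝ≥0∞ :=
  ⨆ x : ι → X, ∑' t, A t * (t.cost x : ℝ≥0∞)

end RandomizedAlgorithm

/-- The (worst-case) `ε`-error randomized query complexity of `f`. -/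
def randomizedQueryComplexity {ι X : Type} (ε : ℝ) (f : (ι → X) → Bool) : ℝ≥0∞ :=
  ⨅ (A : RandomizedAlgorithm ι X) (_ : A.Computes f ε), A.worstCost

/-- The average `ε`-error randomized query complexity of `f`. -/
def averageQueryComplexity {ι X : Type} (ε : ℝ) (f : (ι → X) → Bool) : ℝ≥0∞ :=
  ⨅ (A : RandomizedAlgorithm ι X) (_ : A.Computes f ε), A.averageCost

end

/-! ### A linear code all of whose short views are uniform -/

theorem two_mul_card_dotProduct_eq_zero {w : ℕ} {u : Fin w → ZMod 2} (hu : u ≠ 0) :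
    2 * (Finset.univ.filter fun v : Fin w → ZMod 2 => u ⬝ᵥ v = 0).card = 2 ^ w := by
  obtain ⟨k, hk⟩ : ∃ k, u k ≠ 0 := by
    by_contra h
    push Not at h
    exact hu (funext h)
  have hk1 : u k = 1 := by
    generalize u k = z at hk
    revert z
    decide
  have hflip : ∀ v : Fin w → ZMod 2, u ⬝ᵥ (v + Pi.single k 1) = u ⬝ᵥ v + 1 := by
    intro v
    rw [dotProduct_add, dotProduct_single, hk1, mul_one]
  have h2 : ∀ z : ZMod 2, z + 1 + 1 = z := by decide
  have hinv : ∀ v : Fin w → ZMod 2, v + Pi.single k 1 + Pi.single k 1 = v := by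
    intro v
    funext i
    simp only [Pi.add_apply]
    rcases eq_or_ne i k with rfl | hi
    · simp [h2]
    · simp [Pi.single_eq_of_ne hi]
  have hcard : (Finset.univ.filter fun v : Fin w → ZMod 2 => u ⬝ᵥ v = 0).card =
      (Finset.univ.filter fun v : Fin w → ZMod 2 => ¬ u ⬝ᵥ v = 0).card := by
    refine Finset.card_bij' (fun v _ => v + Pi.single k 1) (fun v _ => v + Pi.single k 1)
      ?_ ?_ (fun v _ => hinv v) (fun v _ => hinv v)
    · intro v hv
      simp only [Finset.mem_filter, Finset.mem_univ, true_and] at hv ⊢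
      rw [hflip, hv]
      decide
    · intro v hv
      simp only [Finset.mem_filter, Finset.mem_univ, true_and] at hv ⊢
      rw [hflip]
      generalize u ⬝ᵥ v = z at hv
      revert z
      decide
  have hsum := Finset.card_filter_add_card_filter_not
    (s := (Finset.univ : Finset (Fin w → ZMod 2))) (fun v => u ⬝ᵥ v = 0)
  rw [← hcard] at hsum
  simp only [Finset.card_univ, Fintype.card_pi, ZMod.card, Finset.prod_const,
    Fintype.card_fin] at hsum
  omega

theorem card_filter_mul_le_sum {α : Type*} [Fintype α] (p : α → Prop) [DecidablePred p]
    (f : α → ℕ) (a : ℕ) (h : ∀ x, p x → a ≤ f x) :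
    (Finset.univ.filter p).card * a ≤ ∑ x, f x := by
  rw [← smul_eq_mul]
  exact (Finset.card_nsmul_le_sum _ f a fun x hx => h x (Finset.mem_filter.1 hx).2).trans
    (Finset.sum_le_sum_of_subset (Finset.filter_subset _ _))

theorem card_light_le {w : ℕ} {u : Fin w → ZMod 2} (hu : u ≠ 0) :
    (Finset.univ.filter fun H : Fin (16 * w) → Fin w → ZMod 2 =>
      (Finset.univ.filter fun i => u ⬝ᵥ H i ≠ 0).card < w).card * 2 ^ (46 * w) ≤
      5 ^ (16 * w) * 2 ^ (w * (16 * w)) := by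
  set wt : (Fin w → ZMod 2) → ℕ := fun v => if u ⬝ᵥ v = 0 then 4 else 1 with hwt
  have hS : 2 * ∑ v, wt v = 5 * 2 ^ w := by
    have h1 := two_mul_card_dotProduct_eq_zero hu
    have hsum := Finset.card_filter_add_card_filter_not
      (s := (Finset.univ : Finset (Fin w → ZMod 2))) (fun v => u ⬝ᵥ v = 0)
    simp only [Finset.card_univ, Fintype.card_pi, ZMod.card, Finset.prod_const,
      Fintype.card_fin] at hsum
    rw [hwt, Finset.sum_ite]
    simp only [Finset.sum_const, smul_eq_mul]
    omega
  have hprod : ∀ H : Fin (16 * w) → Fin w → ZMod 2,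
      (Finset.univ.filter fun i => u ⬝ᵥ H i ≠ 0).card < w → 2 ^ (30 * w) ≤ ∏ i, wt (H i) := by
    intro H hH
    have hsum := Finset.card_filter_add_card_filter_not
      (s := (Finset.univ : Finset (Fin (16 * w)))) (fun i => u ⬝ᵥ H i = 0)
    simp only [Finset.card_univ, Fintype.card_fin] at hsum
    rw [hwt, Finset.prod_ite]
    simp only [Finset.prod_const, one_pow, mul_one]
    rw [show (4 : ℕ) = 2 ^ 2 by norm_num, ← pow_mul]
    refine Nat.pow_le_pow_right (by norm_num) ?_
    simp only [ne_eq] at hH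
    omega
  have htot : (Finset.univ.filter fun H : Fin (16 * w) → Fin w → ZMod 2 =>
      (Finset.univ.filter fun i => u ⬝ᵥ H i ≠ 0).card < w).card * 2 ^ (30 * w) ≤
      (∑ v, wt v) ^ (16 * w) := by
    rw [Fintype.sum_pow]
    exact card_filter_mul_le_sum _ _ _ hprod
  have hscale : ∀ c : ℕ, c * 2 ^ (30 * w) ≤ (∑ v, wt v) ^ (16 * w) →
      c * 2 ^ (46 * w) ≤ 5 ^ (16 * w) * 2 ^ (w * (16 * w)) := by
    intro c hc
    calc c * 2 ^ (46 * w) = c * 2 ^ (30 * w) * 2 ^ (16 * w) := by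
          rw [mul_assoc, ← pow_add, ← add_mul]
      _ ≤ (∑ v, wt v) ^ (16 * w) * 2 ^ (16 * w) := Nat.mul_le_mul_right _ hc
      _ = (5 * 2 ^ w) ^ (16 * w) := by rw [← mul_pow, mul_comm, hS]
      _ = _ := by rw [mul_pow, ← pow_mul]
  exact hscale _ htot

theorem exists_code_no_light_combination {w : ℕ} (hw : 0 < w) :
    ∃ H : Fin (16 * w) → Fin w → ZMod 2, ∀ u : Fin w → ZMod 2, u ≠ 0 →
      w ≤ (Finset.univ.filter fun i => u ⬝ᵥ H i ≠ 0).card := by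
  by_contra hcon
  push Not at hcon
  set light : (Fin w → ZMod 2) → Finset (Fin (16 * w) → Fin w → ZMod 2) := fun u =>
    Finset.univ.filter fun H => (Finset.univ.filter fun i => u ⬝ᵥ H i ≠ 0).card < w
  have hcover : (Finset.univ : Finset (Fin (16 * w) → Fin w → ZMod 2)) ⊆
      (Finset.univ.filter fun u : Fin w → ZMod 2 => u ≠ 0).biUnion light := by
    intro H _
    obtain ⟨u, hu, hl⟩ := hcon H
    simp only [Finset.mem_biUnion, Finset.mem_filter, Finset.mem_univ, true_and, light]
    exact ⟨u, hu, hl⟩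
  have h1 : 2 ^ (w * (16 * w)) * 2 ^ (46 * w) ≤ 2 ^ w * (5 ^ (16 * w) * 2 ^ (w * (16 * w))) := by
    have hc := (Finset.card_le_card hcover).trans Finset.card_biUnion_le
    simp only [Finset.card_univ, Fintype.card_pi, ZMod.card, Finset.prod_const,
      Fintype.card_fin, ← pow_mul] at hc
    refine (Nat.mul_le_mul_right _ hc).trans ?_
    rw [Finset.sum_mul]
    refine (Finset.sum_le_card_nsmul _ _ _ fun u hu =>
      card_light_le (Finset.mem_filter.1 hu).2).trans ?_
    rw [smul_eq_mul]
    refine Nat.mul_le_mul_right _ ((Finset.card_filter_le _ _).trans ?_)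
    simp
  have h2 : 2 ^ (46 * w) ≤ 2 ^ w * 5 ^ (16 * w) := by
    refine le_of_mul_le_mul_left (a := 2 ^ (w * (16 * w))) (h1.trans_eq ?_) (by positivity)
    ring
  rw [pow_mul, pow_mul, ← mul_pow] at h2
  exact absurd h2 (not_le.2 (Nat.pow_lt_pow_left (by norm_num) hw.ne'))

/-- Vectors in `𝔽₂ʷ` that still span after the removal of fewer than `w` of them. -/
theorem exists_code_span_compl {w : ℕ} (hw : 0 < w) :
    ∃ H : Fin (16 * w) → Fin w → ZMod 2, ∀ S : Finset (Fin (16 * w)), S.card < w →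
      Submodule.span (ZMod 2) (H '' {i | i ∉ S}) = ⊤ := by
  obtain ⟨H, hH⟩ := exists_code_no_light_combination hw
  refine ⟨H, fun S hS => ?_⟩
  by_contra hne
  obtain ⟨l, hl0, hl⟩ := Submodule.exists_le_ker_of_lt_top _ (lt_top_iff_ne_top.2 hne)
  set u : Fin w → ZMod 2 := fun k => l (Pi.single k 1) with hu
  have hlu : ∀ v, l v = u ⬝ᵥ v := by
    intro v
    rw [LinearMap.pi_apply_eq_sum_univ l v]
    refine Finset.sum_congr rfl fun k _ => ?_
    rw [smul_eq_mul, mul_comm, hu]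
    congr 2
    funext j
    simp [Pi.single_apply, eq_comm]
  have hu0 : u ≠ 0 := by
    intro h
    apply hl0
    ext v
    simp [hlu, h]
  have hsub : (Finset.univ.filter fun i => u ⬝ᵥ H i ≠ 0) ⊆ S := by
    intro i hi
    by_contra hiS
    refine (Finset.mem_filter.1 hi).2 ?_
    rw [← hlu]
    exact hl (Submodule.subset_span ⟨i, hiS, rfl⟩)
  have := (hH u hu0).trans (Finset.card_le_card hsub)
  omega

/-- The syndrome of a block of bits. -/
def syndrome {B w : ℕ} (H : Fin B → Fin w → ZMod 2) (z : Fin B → Bool) : Fin w → ZMod 2 :=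
  ∑ k, (if z k then (1 : ZMod 2) else 0) • H k

theorem syndrome_xor {B w : ℕ} (H : Fin B → Fin w → ZMod 2) (z z' : Fin B → Bool) :
    syndrome H (fun k => xor (z k) (z' k)) = syndrome H z + syndrome H z' := by
  simp only [syndrome, ← Finset.sum_add_distrib, ← add_smul]
  refine Finset.sum_congr rfl fun k _ => ?_
  have hadd : ∀ a b : Bool, (if xor a b then (1 : ZMod 2) else 0) =
      (if a then 1 else 0) + if b then 1 else 0 := by decide
  rw [hadd]

theorem exists_code_syndrome_surjective {w : ℕ} (hw : 0 < w) :
    ∃ H : Fin (16 * w) → Fin w → ZMod 2, ∀ S : Finset (Fin (16 * w)), S.card < w →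
      ∀ s, ∃ z : Fin (16 * w) → Bool, (∀ k ∈ S, z k = false) ∧ syndrome H z = s := by
  classical
  obtain ⟨H, hH⟩ := exists_code_span_compl hw
  refine ⟨H, fun S hS s => ?_⟩
  have hs : s ∈ Submodule.span (ZMod 2) (H '' {i | i ∉ S}) := by rw [hH S hS]; trivial
  induction hs using Submodule.span_induction with
  | mem x hx =>
    obtain ⟨i, hi, rfl⟩ := hx
    refine ⟨fun k => decide (k = i), fun k hk => ?_, ?_⟩
    · simp only [decide_eq_false_iff_not]
      rintro rfl
      exact hi hk
    · simp [syndrome, ite_smul]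
  | zero => exact ⟨fun _ => false, by simp, by simp [syndrome]⟩
  | add x y _ _ hx hy =>
    obtain ⟨z, hz, rfl⟩ := hx
    obtain ⟨z', hz', rfl⟩ := hy
    exact ⟨_, fun k hk => by simp [hz k hk, hz' k hk], syndrome_xor H z z'⟩
  | smul a x _ hx =>
    have ha : ∀ a : ZMod 2, a = 0 ∨ a = 1 := by decide
    rcases ha a with rfl | rfl
    · exact ⟨fun _ => false, by simp, by simp [syndrome]⟩
    · simpa using hx

/-! ### Queried coordinates and inputs hidden by an encoding -/

namespace DecisionTree

variable {ι : Type} [DecidableEq ι]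

/-- The set of coordinates queried on input `y`. -/
def queried : DecisionTree ι Bool → (ι → Bool) → Finset ι
  | leaf _, _ => ∅
  | query i next, y => insert i ((next (y i)).queried y)

theorem card_queried_le_cost (t : DecisionTree ι Bool) (y : ι → Bool) :
    (t.queried y).card ≤ t.cost y := by
  induction t with
  | leaf b => simp [queried]
  | query i next ih =>
    simp only [queried, cost]
    exact (Finset.card_insert_le _ _).trans (Nat.succ_le_succ (ih (y i)))

theorem run_congr (t : DecisionTree ι Bool) {y y' : ι → Bool}
    (h : ∀ i ∈ t.queried y, y' i = y i) :
    t.eval y' = t.eval y ∧ t.queried y' = t.queried y := by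
  induction t with
  | leaf b => exact ⟨rfl, rfl⟩
  | query i next ih =>
    simp only [queried, Finset.mem_insert, forall_eq_or_imp] at h
    simp only [queried, eval, h.1]
    obtain ⟨h1, h2⟩ := ih (y i) h.2
    exact ⟨h1, by rw [h2]⟩

end DecisionTree

section Hiding

set_option linter.unusedSectionVars false

variable {ι C V : Type} [Fintype ι] [DecidableEq ι] [Fintype C] [DecidableEq C] [AddCommGroup V]
  [DecidableEq V]

/-- The cells of which at least `d` coordinates lie in `Q`. -/
def touched (cell : ι → C) (d : ℕ) (Q : Finset ι) : Finset C :=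
  Finset.univ.filter fun c => d ≤ (Q.filter fun i => cell i = c).card

theorem mul_card_touched_le (cell : ι → C) (d : ℕ) (Q : Finset ι) :
    d * (touched cell d Q).card ≤ Q.card := by
  rw [Finset.card_eq_sum_card_fiberwise (f := cell) (t := Finset.univ) (by simp), mul_comm,
    ← smul_eq_mul]
  exact (Finset.card_nsmul_le_sum (touched cell d Q) (fun c => (Q.filter fun i => cell i = c).card)
    d fun c hc => (Finset.mem_filter.1 hc).2).trans
    (Finset.sum_le_sum_of_subset (Finset.subset_univ _))

/-- The encoding `sym` of cell contents by bits hides the content of every cell of which fewer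
than `d` bits are known. -/
def Hides (cell : ι → C) (sym : (ι → Bool) → C → V) (d : ℕ) : Prop :=
  ∀ (Q : Finset ι) (g : C → V), (∀ c ∈ touched cell d Q, g c = 0) →
    ∃ δ : ι → Bool, (∀ i ∈ Q, δ i = false) ∧
      ∀ y, sym (fun i => xor (y i) (δ i)) = sym y + g

/-- The bit strings that encode `x`. -/
def encodings (sym : (ι → Bool) → C → V) (x : C → V) : Finset (ι → Bool) :=
  Finset.univ.filter fun y => sym y = x

variable {cell : ι → C} {sym : (ι → Bool) → C → V} {d : ℕ}

theorem mem_encodings {x : C → V} {y : ι → Bool} : y ∈ encodings sym x ↔ sym y = x := by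
  simp [encodings]

theorem Hides.card_transfer (hs : Hides cell sym d) (t : DecisionTree ι Bool)
    (p : Bool → Finset ι → Prop) [∀ o Q, Decidable (p o Q)] {x x' : C → V}
    (hp : ∀ o Q, p o Q → ∀ c ∈ touched cell d Q, x c = x' c) :
    ((encodings sym x).filter fun y => p (t.eval y) (t.queried y)).card ≤
      ((encodings sym x').filter fun y => p (t.eval y) (t.queried y)).card := by
  have hex : ∀ Q : Finset ι, ∃ δ : ι → Bool, (∀ i ∈ Q, δ i = false) ∧
      ((∀ c ∈ touched cell d Q, x c = x' c) →
        ∀ y, sym (fun i => xor (y i) (δ i)) = sym y + (x' - x)) := by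
    intro Q
    by_cases h : ∀ c ∈ touched cell d Q, x c = x' c
    · obtain ⟨δ, h1, h2⟩ := hs Q (x' - x) fun c hc => by simp [h c hc]
      exact ⟨δ, h1, fun _ => h2⟩
    · exact ⟨fun _ => false, fun _ _ => rfl, fun h' => absurd h' h⟩
  choose δ hδ0 hδ using hex
  have hrun : ∀ y, t.eval (fun i => xor (y i) (δ (t.queried y) i)) = t.eval y ∧
      t.queried (fun i => xor (y i) (δ (t.queried y) i)) = t.queried y := by
    intro y
    exact t.run_congr fun i hi => by simp [hδ0 _ i hi]
  refine Finset.card_le_card_of_injOn (fun y i => xor (y i) (δ (t.queried y) i)) ?_ ?_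
  · intro y hy
    have hy' := Finset.mem_filter.1 (Finset.mem_coe.1 hy)
    refine Finset.mem_coe.2 (Finset.mem_filter.2 ⟨mem_encodings.2 ?_, ?_⟩)
    · rw [hδ _ (hp _ _ hy'.2), mem_encodings.1 hy'.1]
      abel
    · rw [(hrun y).1, (hrun y).2]
      exact hy'.2
  · intro y _ y' _ hyy
    have hq : t.queried y = t.queried y' := by
      rw [← (hrun y).2, ← (hrun y').2]
      exact congrArg _ hyy
    funext i
    have := congrFun hyy i
    simp only [hq] at this
    have hcancel : ∀ a b c : Bool, xor a c = xor b c → a = b := by decide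
    exact hcancel _ _ _ this

theorem touched_empty (hd : 0 < d) : touched cell d ∅ = ∅ := by
  ext c
  simp [touched, hd.ne']

theorem Hides.card_encodings_eq (hs : Hides cell sym d) (hd : 0 < d) (x x' : C → V) :
    (encodings sym x).card = (encodings sym x').card := by
  have key : ∀ x x' : C → V, (encodings sym x).card ≤ (encodings sym x').card := by
    intro x x'
    have := hs.card_transfer (.leaf true) (fun _ Q => Q = ∅) (x := x) (x' := x')
      (fun o Q hQ c hc => by subst hQ; simp [touched_empty hd] at hc)
    simpa [DecisionTree.queried] using this
  exact le_antisymm (key _ _) (key _ _)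

theorem Hides.encodings_nonempty (hs : Hides cell sym d) (hd : 0 < d) (x : C → V) :
    (encodings sym x).Nonempty := by
  rw [← Finset.card_pos, hs.card_encodings_eq hd x (sym fun _ => false)]
  exact Finset.card_pos.2 ⟨_, mem_encodings.2 rfl⟩

open scoped BigOperators

/-- The probability of the event `p` (about output and set of queries) on a random encoding
of `x`. -/
noncomputable def eventProb (sym : (ι → Bool) → C → V) (t : DecisionTree ι Bool) (x : C → V)
    (p : Bool → Finset ι → Prop) [∀ o Q, Decidable (p o Q)] : ℝ :=
  𝔼 y ∈ encodings sym x, if p (t.eval y) (t.queried y) then (1 : ℝ) else 0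

theorem eventProb_eq_div (t : DecisionTree ι Bool) (x : C → V)
    (p : Bool → Finset ι → Prop) [∀ o Q, Decidable (p o Q)] :
    eventProb sym t x p =
      ((encodings sym x).filter fun y => p (t.eval y) (t.queried y)).card /
        (encodings sym x).card := by
  rw [eventProb, Finset.expect_eq_sum_div_card, Finset.sum_boole]

theorem Hides.eventProb_le (hs : Hides cell sym d) (hd : 0 < d) (t : DecisionTree ι Bool)
    (p : Bool → Finset ι → Prop) [∀ o Q, Decidable (p o Q)] {x x' : C → V}
    (hp : ∀ o Q, p o Q → ∀ c ∈ touched cell d Q, x c = x' c) :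
    eventProb sym t x p ≤ eventProb sym t x' p := by
  rw [eventProb_eq_div, eventProb_eq_div, hs.card_encodings_eq hd x x']
  exact div_le_div_of_nonneg_right (by exact_mod_cast hs.card_transfer t p hp) (by positivity)

theorem Hides.eventProb_touched_le (hs : Hides cell sym d) (hd : 0 < d)
    (t : DecisionTree ι Bool) (c : C) {x x' : C → V} (hx : ∀ c', c' ≠ c → x c' = x' c') :
    eventProb sym t x (fun _ Q => c ∈ touched cell d Q) ≤
      eventProb sym t x' (fun _ Q => c ∈ touched cell d Q) := by
  have hcompl : ∀ x : C → V, eventProb sym t x (fun _ Q => c ∈ touched cell d Q) =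
      1 - eventProb sym t x (fun _ Q => ¬ c ∈ touched cell d Q) := by
    intro x
    have hpos : ((encodings sym x).card : ℝ) ≠ 0 := by
      exact_mod_cast (Finset.card_pos.2 (hs.encodings_nonempty hd x)).ne'
    rw [eventProb_eq_div, eventProb_eq_div, eq_sub_iff_add_eq, ← add_div, div_eq_one_iff_eq hpos]
    exact_mod_cast Finset.card_filter_add_card_filter_not
      (s := encodings sym x) (fun y => c ∈ touched cell d (t.queried y))
  rw [hcompl, hcompl]
  have := hs.eventProb_le hd t (fun _ Q => ¬ c ∈ touched cell d Q) (x := x') (x' := x)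
    (fun o Q hQ c' hc' => (hx c' (by rintro rfl; exact hQ hc')).symm)
  linarith

theorem eventProb_mono (t : DecisionTree ι Bool) (x : C → V)
    {p p' : Bool → Finset ι → Prop} [∀ o Q, Decidable (p o Q)] [∀ o Q, Decidable (p' o Q)]
    (h : ∀ o Q, p o Q → p' o Q) : eventProb sym t x p ≤ eventProb sym t x p' := by
  refine Finset.expect_le_expect fun y _ => ?_
  split_ifs with h1 h2 h2
  · exact le_rfl
  · exact absurd (h _ _ h1) h2
  · exact zero_le_one
  · exact le_rfl

/-- The expected number of touched cells on a random encoding of `x`. -/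
noncomputable def expectedTouched (cell : ι → C) (sym : (ι → Bool) → C → V) (d : ℕ)
    (t : DecisionTree ι Bool) (x : C → V) : ℝ :=
  𝔼 y ∈ encodings sym x, ((touched cell d (t.queried y)).card : ℝ)

end Hiding

/-! ### Averages over a randomized algorithm -/

/-- The average of `φ` over the trees of `A` is at most `v`. -/
def AverageLE {ι : Type} (A : RandomizedAlgorithm ι Bool) (φ : DecisionTree ι Bool → ℝ) (v : ℝ) :
    Prop :=
  ∑' t, A t * ENNReal.ofReal (φ t) ≤ ENNReal.ofReal v

namespace AverageLE

variable {ι : Type} {A : RandomizedAlgorithm ι Bool} {φ ψ : DecisionTree ι Bool → ℝ} {v v' : ℝ}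

theorem mono (h : AverageLE A ψ v) (hle : ∀ t, φ t ≤ ψ t) : AverageLE A φ v :=
  (ENNReal.tsum_le_tsum fun t => by gcongr; exact hle t).trans h

theorem add (h : AverageLE A φ v) (h' : AverageLE A ψ v') (hv : 0 ≤ v) (hv' : 0 ≤ v') :
    AverageLE A (fun t => φ t + ψ t) (v + v') := by
  rw [AverageLE, ENNReal.ofReal_add hv hv']
  refine le_trans ?_ (add_le_add h h')
  rw [← ENNReal.tsum_add]
  refine ENNReal.tsum_le_tsum fun t => ?_
  rw [← mul_add]
  gcongr
  exact ENNReal.ofReal_add_le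

theorem const_mul (h : AverageLE A φ v) {c : ℝ} (hc : 0 ≤ c) :
    AverageLE A (fun t => c * φ t) (c * v) := by
  simp only [AverageLE, ENNReal.ofReal_mul hc]
  calc _ = ∑' t, ENNReal.ofReal c * (A t * ENNReal.ofReal (φ t)) := by
        congr 1; funext t; ring
    _ = ENNReal.ofReal c * ∑' t, A t * ENNReal.ofReal (φ t) := ENNReal.tsum_mul_left
    _ ≤ _ := by gcongr; exact h

theorem sum {κ : Type*} {s : Finset κ} {φ : κ → DecisionTree ι Bool → ℝ}
    (h : ∀ i ∈ s, AverageLE A (φ i) v) (hv : 0 ≤ v) :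
    AverageLE A (fun t => ∑ i ∈ s, φ i t) (s.card * v) := by
  classical
  induction s using Finset.induction_on with
  | empty => simp [AverageLE]
  | insert a s ha ih =>
    rw [Finset.card_insert_of_notMem ha, Nat.cast_succ, add_mul, one_mul, add_comm]
    simp only [Finset.sum_insert ha]
    exact (h a (Finset.mem_insert_self _ _)).add
      (ih fun i hi => h i (Finset.mem_insert_of_mem hi)) hv (by positivity)

theorem expect {κ : Type*} {s : Finset κ} {φ : κ → DecisionTree ι Bool → ℝ}
    (h : ∀ i ∈ s, AverageLE A (φ i) v) (hv : 0 ≤ v) :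
    AverageLE A (fun t => s.expect fun i => φ i t) v := by
  have h1 := (sum h hv).const_mul (c := (s.card : ℝ)⁻¹) (by positivity)
  simp only [Finset.expect_eq_sum_div_card, div_eq_inv_mul]
  refine h1.trans (ENNReal.ofReal_le_ofReal ?_)
  rw [← mul_assoc]
  exact mul_le_of_le_one_left hv (by rw [mul_comm]; exact mul_inv_le_one)

theorem one_le (h : AverageLE A φ v) (h1 : ∀ t, 1 ≤ φ t) : 1 ≤ v := by
  have : (1 : ℝ≥0∞) ≤ ENNReal.ofReal v := by
    rw [← A.tsum_coe]
    refine le_trans (ENNReal.tsum_le_tsum fun t => ?_) h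
    exact le_mul_of_one_le_right zero_le (ENNReal.one_le_ofReal.2 (h1 t))
  exact ENNReal.one_le_ofReal.1 this

theorem error {f : (ι → Bool) → Bool} {ε : ℝ} (hA : A.Computes f ε) (y : ι → Bool) :
    AverageLE A (fun t => if t.eval y = !f y then 1 else 0) ε := by
  have hsum : A.output y (f y) +
      ∑' t, A t * ENNReal.ofReal (if t.eval y = !f y then 1 else 0) = 1 := by
    rw [RandomizedAlgorithm.output, PMF.map_apply, ← ENNReal.tsum_add, ← A.tsum_coe]
    congr 1
    funext t
    cases hf : f y <;> cases ht : t.eval y <;> simp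
  have hne : A.output y (f y) ≠ ∞ := PMF.apply_ne_top _ _
  have hA' := hA y
  set E := ∑' t, A t * ENNReal.ofReal (if t.eval y = !f y then 1 else 0)
  have hE : E ≠ ∞ := by
    intro h
    simp [h] at hsum
  have hr : (A.output y (f y)).toReal + E.toReal = 1 := by
    rw [← ENNReal.toReal_add hne hE, hsum, ENNReal.toReal_one]
  change E ≤ _
  rw [← ENNReal.ofReal_toReal hE]
  exact ENNReal.ofReal_le_ofReal (by linarith)

theorem card_queried [DecidableEq ι] {q : ℝ} (hA : A.averageCost ≤ ENNReal.ofReal q)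
    (y : ι → Bool) : AverageLE A (fun t => ((t.queried y).card : ℝ)) q := by
  refine le_trans ?_ ((le_iSup (fun y => ∑' t, A t * (t.cost y : ℝ≥0∞)) y).trans hA)
  refine ENNReal.tsum_le_tsum fun t => ?_
  gcongr
  rw [ENNReal.ofReal_natCast]
  exact_mod_cast t.card_queried_le_cost y

end AverageLE

/-! ### Functions that are computed adaptively with few queries -/

/-- `F` can be computed by an adaptive procedure that makes at most `c` queries; the procedure
is given in continuation-passing style. -/
def Implementable {ι X α : Type} (F : (ι → X) → α) (c : ℕ) : Prop :=
  ∃ P : (α → DecisionTree ι X) → DecisionTree ι X, ∀ k y,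
    (P k).eval y = (k (F y)).eval y ∧ (P k).cost y ≤ (k (F y)).cost y + c

namespace Implementable

variable {ι X α β : Type}

theorem const (a : α) (c : ℕ) : Implementable (fun _ : ι → X => a) c :=
  ⟨fun k => k a, fun _ _ => ⟨rfl, Nat.le_add_right _ _⟩⟩

theorem coord (i : ι) : Implementable (fun y : ι → X => y i) 1 :=
  ⟨fun k => .query i k, fun _ _ => ⟨rfl, le_rfl⟩⟩

theorem bind {F : (ι → X) → α} {G : α → (ι → X) → β} {c c' : ℕ} (hF : Implementable F c)
    (hG : ∀ a, Implementable (G a) c') : Implementable (fun y => G (F y) y) (c + c') := by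
  obtain ⟨P, hP⟩ := hF
  choose P' hP' using hG
  refine ⟨fun k => P fun a => P' a k, fun k y => ⟨?_, ?_⟩⟩
  · rw [(hP _ y).1, (hP' _ _ y).1]
  · have h1 := (hP (fun a => P' a k) y).2
    have h2 := (hP' (F y) k y).2
    change (P fun a => P' a k).cost y ≤ (k (G (F y) y)).cost y + (c + c')
    omega

theorem map {F : (ι → X) → α} {c : ℕ} (hF : Implementable F c) (g : α → β) :
    Implementable (fun y => g (F y)) c :=
  hF.bind (c' := 0) fun a => const (g a) 0

theorem mono {F : (ι → X) → α} {c c' : ℕ} (hF : Implementable F c) (h : c ≤ c') :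
    Implementable F c' := by
  obtain ⟨P, hP⟩ := hF
  exact ⟨P, fun k y => ⟨(hP k y).1, (hP k y).2.trans (by omega)⟩⟩

theorem foldl {σ : Type} {step : σ → α → (ι → X) → σ} {c : ℕ}
    (h : ∀ s a, Implementable (step s a) c) (l : List α) (s : σ) :
    Implementable (fun y => l.foldl (fun s a => step s a y) s) (l.length * c) := by
  induction l generalizing s with
  | nil => exact const s _
  | cons a l ih =>
    refine ((h s a).bind fun s' => ih s').mono ?_
    rw [List.length_cons]
    ring_nf
    exact le_rfl

theorem pi {m : ℕ} {F : Fin m → (ι → X) → α} {c : ℕ} (h : ∀ a, Implementable (F a) c) :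
    Implementable (fun y a => F a y) (m * c) := by
  induction m with
  | zero =>
    have h0 : (fun (y : ι → X) a => F a y) = fun _ a => a.elim0 := by
      funext y a
      exact a.elim0
    rw [h0]
    exact const _ _
  | succ m ih =>
    have h1 := (h 0).bind (c' := m * c) 
      (G := fun a y => (Fin.cons a fun j => F j.succ y : Fin (m + 1) → α))
      fun a => (ih fun j => h j.succ).map fun g => (Fin.cons a g : Fin (m + 1) → α)
    have h2 : (fun (y : ι → X) a => F a y) = fun y => Fin.cons (F 0 y) fun j => F j.succ y := by
      funext y a
      refine Fin.cases ?_ (fun j => ?_) a <;> simp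
    rw [h2]
    refine h1.mono ?_
    ring_nf
    exact le_rfl

theorem exists_tree {F : (ι → X) → Bool} {c : ℕ} (hF : Implementable F c) :
    ∃ t : DecisionTree ι X, ∀ y, t.eval y = F y ∧ t.cost y ≤ c := by
  obtain ⟨P, hP⟩ := hF
  refine ⟨P .leaf, fun y => ⟨(hP _ y).1, ?_⟩⟩
  simpa [DecisionTree.cost] using (hP .leaf y).2

end Implementable

/-! ### The pointer function -/

/-- The possible contents of a cell. -/
inductive Entry (n : ℕ) : Type
  | zero : Entry n
  | one : Entry n
  | cert (r s : Fin n → Fin n) : Entry n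
  | ptr (i b : Fin n) : Entry n

/-- The cells of two `n × n` arrays: side (`false` is left), row, column. -/
abbrev Cell (n : ℕ) : Type := Bool × Fin n × Fin n

section PointerFunction

open Classical

variable {n : ℕ}

/-- Column `b` on the left consists of ones and one certificate `(r, s)` in row `i`; the list `r`
locates a zero in every other column on the left, and two thirds of the cells on the right located
by `s` point back to the certificate. -/
def IsCertified (x : Cell n → Entry n) (i b : Fin n) (r s : Fin n → Fin n) : Prop :=
  x (false, i, b) = .cert r s ∧ (∀ i', i' ≠ i → x (false, i', b) = .one) ∧
    (∀ b', b' ≠ b → x (false, r b', b') = .zero) ∧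
    2 * n ≤ 3 * (Finset.univ.filter fun j => x (true, s j, j) = .ptr i b).card

/-- Some column is certified. -/
def Accepts (x : Cell n → Entry n) : Prop := ∃ i b r s, IsCertified x i b r s

/-- One step of the elimination: compare the current candidate with the one that the cell in row
`a` of the right column `j` points to. -/
noncomputable def eliminate (x : Cell n → Entry n) (j : Fin n)
    (st : Option (Fin n × Fin n × (Fin n → Fin n) × (Fin n → Fin n))) (a : Fin n) :
    Option (Fin n × Fin n × (Fin n → Fin n) × (Fin n → Fin n)) :=
  match x (true, a, j) with
  | .ptr i b =>
    match x (false, i, b) with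
    | .cert r s =>
      match st with
      | none => some (i, b, r, s)
      | some (_, b₁, r₁, _) =>
        if b = b₁ then st
        else if x (false, r₁ b, b) = .zero then st
        else some (i, b, r, s)
    | _ => st
  | _ => st

/-- The candidate that survives the elimination in column `j`. -/
noncomputable def survivor (x : Cell n → Entry n) (j : Fin n) :
    Option (Fin n × Fin n × (Fin n → Fin n) × (Fin n → Fin n)) :=
  (List.finRange n).foldl (eliminate x j) none

/-- Whether the surviving candidate is certified. -/
noncomputable def survivorTest (x : Cell n → Entry n) (j : Fin n) : Bool :=
  match survivor x j with
  | none => false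
  | some (i, b, r, s) => decide (IsCertified x i b r s)

theorem accepts_of_survivorTest {x : Cell n → Entry n} {j : Fin n}
    (h : survivorTest x j = true) : Accepts x := by
  rw [survivorTest] at h
  split at h
  · cases h
  · exact ⟨_, _, _, _, of_decide_eq_true h⟩

theorem eliminate_eq_some_of_state {x : Cell n → Entry n} {i b : Fin n} {r s : Fin n → Fin n}
    (hx : IsCertified x i b r s) (j a : Fin n) :
    eliminate x j (some (i, b, r, s)) a = some (i, b, r, s) := by
  unfold eliminate
  split
  · split
    · split
      · rename_i h; cases h
      · rename_i i' b' _ r' s' _ _ _ _ _ _ h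
        cases h
        split_ifs with h1 h2
        · rfl
        · rfl
        · exact absurd (hx.2.2.1 _ h1) h2
    · rfl
  · rfl

theorem eliminate_eq_some_of_ptr {x : Cell n → Entry n} {i b : Fin n} {r s : Fin n → Fin n}
    (hx : IsCertified x i b r s) {j a : Fin n} (ha : x (true, a, j) = .ptr i b)
    {st : Option (Fin n × Fin n × (Fin n → Fin n) × (Fin n → Fin n))}
    (hst : ∀ i₁ b₁ r₁ s₁, st = some (i₁, b₁, r₁, s₁) → x (false, i₁, b₁) = .cert r₁ s₁) :
    eliminate x j st a = some (i, b, r, s) := by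
  unfold eliminate
  rw [ha]
  simp only [hx.1]
  rcases st with _ | ⟨i₁, b₁, r₁, s₁⟩
  · rfl
  · have h1 := hst _ _ _ _ rfl
    simp only
    split_ifs with hb hz
    · subst hb
      rcases eq_or_ne i₁ i with rfl | hi
      · rw [hx.1] at h1
        cases h1
        rfl
      · rw [hx.2.1 i₁ hi] at h1
        cases h1
    · rcases eq_or_ne (r₁ b) i with hi | hi
      · rw [hi, hx.1] at hz
        cases hz
      · rw [hx.2.1 _ hi] at hz
        cases hz
    · rfl

theorem eliminate_cert {x : Cell n → Entry n} {j a : Fin n}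
    {st : Option (Fin n × Fin n × (Fin n → Fin n) × (Fin n → Fin n))}
    (hst : ∀ i₁ b₁ r₁ s₁, st = some (i₁, b₁, r₁, s₁) → x (false, i₁, b₁) = .cert r₁ s₁) :
    ∀ i₁ b₁ r₁ s₁, eliminate x j st a = some (i₁, b₁, r₁, s₁) →
      x (false, i₁, b₁) = .cert r₁ s₁ := by
  intro i₁ b₁ r₁ s₁ h
  unfold eliminate at h
  split at h
  · split at h
    · rename_i hc
      split at h
      · cases h
        exact hc
      · split_ifs at h with h1 h2
        · exact hst _ _ _ _ h
        · exact hst _ _ _ _ h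
        · cases h
          exact hc
    · exact hst _ _ _ _ h
  · exact hst _ _ _ _ h

theorem foldl_eliminate_eq_some {x : Cell n → Entry n} {i b : Fin n} {r s : Fin n → Fin n}
    (hx : IsCertified x i b r s) {j : Fin n} (hj : x (true, s j, j) = .ptr i b)
    (l : List (Fin n)) (st : Option (Fin n × Fin n × (Fin n → Fin n) × (Fin n → Fin n)))
    (hst : ∀ i₁ b₁ r₁ s₁, st = some (i₁, b₁, r₁, s₁) → x (false, i₁, b₁) = .cert r₁ s₁)
    (hl : s j ∈ l ∨ st = some (i, b, r, s)) :
    l.foldl (eliminate x j) st = some (i, b, r, s) := by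
  induction l generalizing st with
  | nil => simpa using hl
  | cons a l ih =>
    rw [List.foldl_cons]
    refine ih _ (eliminate_cert hst) ?_
    rcases hl with hl | rfl
    · rcases List.mem_cons.1 hl with rfl | hl
      · exact Or.inr (eliminate_eq_some_of_ptr hx hj hst)
      · exact Or.inl hl
    · exact Or.inr (eliminate_eq_some_of_state hx j a)

theorem survivorTest_eq_true {x : Cell n → Entry n} {i b : Fin n} {r s : Fin n → Fin n}
    (hx : IsCertified x i b r s) {j : Fin n} (hj : x (true, s j, j) = .ptr i b) :
    survivorTest x j = true := by
  have : survivor x j = some (i, b, r, s) :=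
    foldl_eliminate_eq_some hx hj _ _ (fun _ _ _ _ h => by cases h) (Or.inl (List.mem_finRange _))
  simp [survivorTest, this, hx]

variable {ι : Type} {x : (ι → Bool) → Cell n → Entry n} {B : ℕ}

theorem implementable_eliminate (hx : ∀ c, Implementable (fun y => x y c) B) (j : Fin n)
    (st : Option (Fin n × Fin n × (Fin n → Fin n) × (Fin n → Fin n))) (a : Fin n) :
    Implementable (fun y => eliminate (x y) j st a) (3 * B) := by
  rw [show 3 * B = B + (B + B) by ring]
  refine (hx (true, a, j)).bind (G := fun e y => match e with
    | .ptr i b =>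
      match x y (false, i, b) with
      | .cert r s =>
        match st with
        | none => some (i, b, r, s)
        | some (_, b₁, r₁, _) =>
          if b = b₁ then st
          else if x y (false, r₁ b, b) = Entry.zero then st
          else some (i, b, r, s)
      | _ => st
    | _ => st) fun e => ?_
  cases e with
  | ptr i b =>
    refine (hx (false, i, b)).bind (G := fun e y => match e with
      | .cert r s =>
        match st with
        | none => some (i, b, r, s)
        | some (_, b₁, r₁, _) =>
          if b = b₁ then st
          else if x y (false, r₁ b, b) = Entry.zero then st
          else some (i, b, r, s)
      | _ => st) fun e => ?_
    cases e with
    | cert r s =>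
      rcases st with _ | ⟨i₁, b₁, r₁, s₁⟩
      · exact .const _ _
      · exact (hx (false, r₁ b, b)).map fun e : Entry n =>
          if b = b₁ then some (i₁, b₁, r₁, s₁) else if e = Entry.zero then some (i₁, b₁, r₁, s₁)
            else some (i, b, r, s)
    | _ => exact .const _ _
  | _ => exact .const _ _

theorem implementable_isCertified (hx : ∀ c, Implementable (fun y => x y c) B) (i b : Fin n)
    (r s : Fin n → Fin n) :
    Implementable (fun y => decide (IsCertified (x y) i b r s)) (n * B + (n * B + n * B)) := by
  have h1 := Implementable.pi fun i' : Fin n => hx (false, i', b)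
  have h2 := Implementable.pi fun b' : Fin n => hx (false, r b', b')
  have h3 := Implementable.pi fun j : Fin n => hx (true, s j, j)
  exact h1.bind fun g => h2.bind fun g' => h3.map fun g'' =>
    @decide (g i = .cert r s ∧ (∀ i', i' ≠ i → g i' = .one) ∧ (∀ b', b' ≠ b → g' b' = .zero) ∧
      2 * n ≤ 3 * (Finset.univ.filter fun j => g'' j = .ptr i b).card) (propDecidable _)

theorem implementable_survivorTest (hx : ∀ c, Implementable (fun y => x y c) B) (j : Fin n) :
    Implementable (fun y => survivorTest (x y) j) (6 * (n * B)) := by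
  have h1 := Implementable.foldl (fun st a => implementable_eliminate hx j st a)
    (List.finRange n) none
  rw [List.length_finRange] at h1
  refine (h1.bind (c' := n * B + (n * B + n * B)) (G := fun st y => match st with
    | none => false
    | some (i, b, r, s) => decide (IsCertified (x y) i b r s)) fun st => ?_).mono ?_
  · rcases st with _ | ⟨i, b, r, s⟩
    · exact .const _ _
    · exact implementable_isCertified hx i b r s
  · ring_nf
    exact le_rfl

theorem randomizedQueryComplexity_accepts_le (hn : 0 < n)
    (hx : ∀ c, Implementable (fun y => x y c) B) :
    randomizedQueryComplexity (1 / 3) (fun y => decide (Accepts (x y))) ≤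
      ((6 * (n * B) : ℕ) : ℝ≥0∞) := by
  have : Nonempty (Fin n) := ⟨⟨0, hn⟩⟩
  choose t ht using fun j => (implementable_survivorTest hx j).exists_tree
  set A : RandomizedAlgorithm ι Bool := (PMF.uniformOfFintype (Fin n)).map t
  have hout : ∀ y o, (A.output y o).toReal =
      ((Finset.univ.filter fun j => o = survivorTest (x y) j).card : ℝ) / n := by
    intro y o
    rw [RandomizedAlgorithm.output, PMF.map_comp, PMF.map_apply, tsum_fintype]
    simp only [Function.comp_apply, (ht _ y).1, PMF.uniformOfFintype_apply, Fintype.card_fin]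
    rw [← Finset.sum_filter, Finset.sum_const, nsmul_eq_mul, ENNReal.toReal_mul]
    simp [div_eq_mul_inv]
  have hcomp : A.Computes (fun y => decide (Accepts (x y))) (1 / 3) := by
    intro y
    have hn' : (0 : ℝ) < n := by exact_mod_cast hn
    rw [hout, le_div_iff₀ hn']
    by_cases hacc : Accepts (x y)
    · obtain ⟨i, b, r, s, h⟩ := hacc
      have hsub : (Finset.univ.filter fun j => x y (true, s j, j) = .ptr i b) ⊆
          Finset.univ.filter fun j => decide (Accepts (x y)) = survivorTest (x y) j := by
        intro j hj
        rw [Finset.mem_filter] at hj ⊢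
        refine ⟨hj.1, ?_⟩
        rw [survivorTest_eq_true h hj.2]
        exact decide_eq_true ⟨i, b, r, s, h⟩
      have h1 := h.2.2.2.trans (Nat.mul_le_mul_left 3 (Finset.card_le_card hsub))
      have h2 : (2 : ℝ) * n ≤ 3 * ((Finset.univ.filter fun j =>
        decide (Accepts (x y)) = survivorTest (x y) j).card : ℝ) := by exact_mod_cast h1
      linarith
    · have hall : (Finset.univ.filter fun j =>
          decide (Accepts (x y)) = survivorTest (x y) j) = Finset.univ := by
        refine Finset.filter_true_of_mem fun j _ => ?_
        rw [decide_eq_false hacc]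
        by_contra h
        exact hacc (accepts_of_survivorTest (Bool.eq_true_of_not_eq_false fun h' => h h'.symm))
      rw [hall]
      simp
      linarith
  refine (iInf₂_le A hcomp).trans ?_
  refine iSup_le fun y => iSup₂_le fun t' ht' => ?_
  obtain ⟨j, -, rfl⟩ := (PMF.mem_support_map_iff _ _ _).1 ht'
  exact_mod_cast (ht j y).2

end PointerFunction

/-! ### Hard inputs -/

section HardInputs

variable {n : ℕ}

/-- One zero in every column on the left. -/
def zeros (u : Fin n → Fin n) : Cell n → Entry n := fun c =>
  if c.1 = false ∧ c.2.1 = u c.2.2 then .zero else .one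

/-- One zero in every column on the left, and a further one in column `b`. -/
def extraZero (u : Fin n → Fin n) (v b : Fin n) : Cell n → Entry n := fun c =>
  if c = (false, v, b) then .zero else zeros u c

/-- Column `b` on the left is certified; the columns in `J` on the right point to the
certificate, all in row `a`. -/
def certified (u : Fin n → Fin n) (b a : Fin n) (J : Finset (Fin n)) : Cell n → Entry n := fun c =>
  if c.1 = true then if c.2.1 = a ∧ c.2.2 ∈ J then .ptr (u b) b else .one
  else if c.2.1 = u c.2.2 then if c.2.2 = b then .cert u fun _ => a else .zero
  else .one

theorem not_accepts_extraZero (u : Fin n → Fin n) (v b : Fin n) : ¬ Accepts (extraZero u v b) := by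
  rintro ⟨i, b', r, s, h, -⟩
  unfold extraZero zeros at h
  split_ifs at h

theorem accepts_certified (u : Fin n → Fin n) (b a : Fin n) {J : Finset (Fin n)}
    (hJ : 2 * n ≤ 3 * J.card) : Accepts (certified u b a J) := by
  refine ⟨u b, b, u, fun _ => a, by simp [certified], fun i hi => by simp [certified, hi],
    fun b' hb' => by simp [certified, hb'], ?_⟩
  refine hJ.trans (Nat.mul_le_mul_left 3 (Finset.card_le_card fun j hj => ?_))
  simp [certified, hj]

theorem extraZero_eq_zeros (u : Fin n → Fin n) (v b : Fin n) {c : Cell n}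
    (hc : c ≠ (false, v, b)) : extraZero u v b c = zeros u c := by
  simp [extraZero, hc]

theorem extraZero_swap (u : Fin n → Fin n) (v b : Fin n) :
    extraZero (Function.update u b v) (u b) b = extraZero u v b := by
  funext ⟨side, i, j⟩
  simp only [extraZero, zeros, Prod.mk.injEq]
  cases side
  · rcases eq_or_ne j b with rfl | hj
    · simp only [true_and, and_true, Function.update_self]
      split_ifs <;> simp_all
    · simp [hj]
  · simp

theorem extraZero_eq_certified (u : Fin n → Fin n) (v b a : Fin n) {J : Finset (Fin n)}
    {c : Cell n} (h1 : c ≠ (false, u b, b)) (h2 : c ≠ (false, v, b))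
    (h3 : ∀ j ∈ J, c ≠ (true, a, j)) : extraZero u v b c = certified u b a J c := by
  obtain ⟨side, i, j⟩ := c
  rw [extraZero_eq_zeros u v b h2]
  cases side
  · simp only [zeros, certified]
    rcases eq_or_ne j b with rfl | hj
    · have : i ≠ u j := by rintro rfl; exact h1 rfl
      simp [this]
    · simp [hj]
  · have : ¬ (i = a ∧ j ∈ J) := by
      rintro ⟨rfl, hj⟩
      exact h3 j hj rfl
    simp [zeros, certified, this]

end HardInputs

/-! ### The lower bound for a single tree -/

section SingleTree

set_option linter.unusedSectionVars false

open scoped BigOperators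

theorem expect_mem_le_card_div {κ C : Type} [Fintype κ] [DecidableEq C] (g : κ → C)
    (hg : Function.Injective g) (T : Finset C) :
    (𝔼 k, if g k ∈ T then (1 : ℝ) else 0) ≤ T.card / Fintype.card κ := by
  rw [Fintype.expect_eq_sum_div_card, Finset.sum_boole]
  refine div_le_div_of_nonneg_right ?_ (by positivity)
  exact_mod_cast Finset.card_le_card_of_injOn g (fun k hk => by simpa using hk) hg.injOn

variable {n : ℕ} {ι V : Type} [Fintype ι] [DecidableEq ι] [AddCommGroup V] [DecidableEq V]
  {cell : ι → Cell n} {sym : (ι → Bool) → Cell n → V} {d : ℕ}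

theorem expect_eventProb_mem_le {κ : Type} [Fintype κ] (g : κ → Cell n)
    (hg : Function.Injective g) (t : DecisionTree ι Bool) (x : Cell n → V) :
    (𝔼 k, eventProb sym t x fun _ Q => g k ∈ touched cell d Q) ≤
      expectedTouched cell sym d t x / Fintype.card κ := by
  unfold eventProb expectedTouched
  rw [Finset.expect_comm, Finset.expect_div]
  exact Finset.expect_le_expect fun y _ => expect_mem_le_card_div g hg _

/-- The columns on the right whose cell in row `a` belongs to `T`. -/
def hitColumns (T : Finset (Cell n)) (a : Fin n) : Finset (Fin n) :=
  Finset.univ.filter fun j => (true, a, j) ∈ T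

theorem expect_eventProb_hitColumns_le (k : ℕ) (t : DecisionTree ι Bool) (x : Cell n → V) :
    (𝔼 a : Fin n, eventProb sym t x fun _ Q => k < (hitColumns (touched cell d Q) a).card) ≤
      expectedTouched cell sym d t x / (n * (k + 1)) := by
  unfold eventProb expectedTouched
  rw [Finset.expect_comm, Finset.expect_div]
  refine Finset.expect_le_expect fun y _ => ?_
  set T := touched cell d (t.queried y)
  have h1 : ∀ a : Fin n, (if k < (hitColumns T a).card then (1 : ℝ) else 0) ≤
      (hitColumns T a).card / (k + 1) := by
    intro a
    split_ifs with h
    · rw [one_le_div (by positivity)]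
      exact_mod_cast h
    · positivity
  refine (Finset.expect_le_expect fun a _ => h1 a).trans ?_
  rw [← Finset.expect_div, ← div_div]
  refine div_le_div_of_nonneg_right ?_ (by positivity)
  rw [Fintype.expect_eq_sum_div_card, Fintype.card_fin]
  refine div_le_div_of_nonneg_right ?_ (by positivity)
  have h2 : ∑ a, (hitColumns T a).card ≤ T.card := by
    rw [← Finset.card_sigma]
    refine Finset.card_le_card_of_injOn (fun p => (true, p.1, p.2)) ?_ ?_
    · rintro ⟨a, j⟩ h
      simpa [hitColumns] using h
    · rintro ⟨a, j⟩ _ ⟨a', j'⟩ _ h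
      simpa using h
  exact_mod_cast h2

variable (enc : Entry n → V)

theorem Hides.expect_extraZero_touched_le (hs : Hides cell sym d) (hd : 0 < d)
    (t : DecisionTree ι Bool) :
    (𝔼 ω : (Fin n → Fin n) × Fin n × Fin n,
      eventProb sym t (fun c => enc (extraZero ω.1 ω.2.1 ω.2.2 c))
        fun _ Q => (false, ω.2.1, ω.2.2) ∈ touched cell d Q) ≤
      𝔼 u : Fin n → Fin n, expectedTouched cell sym d t (fun c => enc (zeros u c)) / n ^ 2 := by
  rw [← Finset.univ_product_univ, Finset.expect_product]
  refine Finset.expect_le_expect fun u _ => ?_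
  refine (Finset.expect_le_expect fun p _ => hs.eventProb_touched_le hd t (false, p.1, p.2)
    (x' := fun c => enc (zeros u c)) fun c hc => ?_).trans ?_
  · simp only [extraZero_eq_zeros u p.1 p.2 hc]
  · refine (expect_eventProb_mem_le (fun p : Fin n × Fin n => (false, p.1, p.2))
      (fun p p' h => by simpa [Prod.ext_iff] using h) t _).trans_eq ?_
    simp [sq]

theorem Hides.expect_extraZero_touched_le' (hs : Hides cell sym d) (hd : 0 < d)
    (t : DecisionTree ι Bool) :
    (𝔼 ω : (Fin n → Fin n) × Fin n × Fin n,
      eventProb sym t (fun c => enc (extraZero ω.1 ω.2.1 ω.2.2 c))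
        fun _ Q => (false, ω.1 ω.2.2, ω.2.2) ∈ touched cell d Q) ≤
      𝔼 u : Fin n → Fin n, expectedTouched cell sym d t (fun c => enc (zeros u c)) / n ^ 2 := by
  refine le_trans (le_of_eq ?_) (hs.expect_extraZero_touched_le enc hd t)
  have hinv : Function.Involutive fun ω : (Fin n → Fin n) × Fin n × Fin n =>
      (Function.update ω.1 ω.2.2 ω.2.1, ω.1 ω.2.2, ω.2.2) := by
    rintro ⟨u, v, b⟩
    simp
  refine Fintype.expect_equiv hinv.toPerm _ _ fun ω => ?_
  simp only [Function.Involutive.coe_toPerm, extraZero_swap]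

variable {Θ : Type} [Fintype Θ] (J : Θ → Finset (Fin n)) {k : ℕ} {D : ℝ}

theorem one_le_eventProb_add (hs : Hides cell sym d) (hd : 0 < d)
    (hJ : ∀ K : Finset (Fin n), K.card ≤ k →
      1 ≤ D * 𝔼 θ, if Disjoint (J θ) K then (1 : ℝ) else 0) (hD : 0 ≤ D)
    (t : DecisionTree ι Bool) (u : Fin n → Fin n) (v b a : Fin n) :
    1 ≤ eventProb sym t (fun c => enc (extraZero u v b c)) (fun o _ => o = true)
      + eventProb sym t (fun c => enc (extraZero u v b c))
          (fun _ Q => (false, u b, b) ∈ touched cell d Q)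
      + eventProb sym t (fun c => enc (extraZero u v b c))
          (fun _ Q => (false, v, b) ∈ touched cell d Q)
      + eventProb sym t (fun c => enc (extraZero u v b c))
          (fun _ Q => k < (hitColumns (touched cell d Q) a).card)
      + D * 𝔼 θ, eventProb sym t (fun c => enc (certified u b a (J θ) c))
          (fun o _ => o = false) := by
  have htransfer : ∀ θ, eventProb sym t (fun c => enc (extraZero u v b c))
      (fun o Q => (o = false ∧ (false, u b, b) ∉ touched cell d Q ∧
        (false, v, b) ∉ touched cell d Q) ∧ Disjoint (J θ) (hitColumns (touched cell d Q) a)) ≤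
      eventProb sym t (fun c => enc (certified u b a (J θ) c)) (fun o _ => o = false) := by
    intro θ
    refine (hs.eventProb_le hd t _ (x' := fun c => enc (certified u b a (J θ) c)) ?_).trans
      (eventProb_mono t _ fun o Q h => h.1.1)
    rintro o Q ⟨⟨-, h1, h2⟩, h3⟩ c hc
    rw [extraZero_eq_certified u v b a (by rintro rfl; exact h1 hc) (by rintro rfl; exact h2 hc)]
    rintro j hj rfl
    exact Finset.disjoint_left.1 h3 hj (by simpa [hitColumns] using hc)
  refine le_trans ?_ (add_le_add_right (mul_le_mul_of_nonneg_left
    (Finset.expect_le_expect fun θ _ => htransfer θ) hD) _)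
  have hne := hs.encodings_nonempty hd (fun c => enc (extraZero u v b c))
  unfold eventProb
  rw [Finset.expect_comm, Finset.mul_expect, ← Finset.expect_add_distrib,
    ← Finset.expect_add_distrib, ← Finset.expect_add_distrib, ← Finset.expect_add_distrib]
  refine Finset.le_expect hne fun y _ => ?_
  have hnn : ∀ p : Prop, [Decidable p] → (0 : ℝ) ≤ if p then 1 else 0 := by
    intro p _
    split_ifs <;> norm_num
  have hlast : (0 : ℝ) ≤ D * 𝔼 θ, if (t.eval y = false ∧
      (false, u b, b) ∉ touched cell d (t.queried y) ∧
      (false, v, b) ∉ touched cell d (t.queried y)) ∧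
      Disjoint (J θ) (hitColumns (touched cell d (t.queried y)) a) then (1 : ℝ) else 0 :=
    mul_nonneg hD (Finset.expect_nonneg fun θ _ => hnn _)
  by_cases h1 : t.eval y = true
  · rw [if_pos h1]
    linarith [hnn ((false, u b, b) ∈ touched cell d (t.queried y)),
      hnn ((false, v, b) ∈ touched cell d (t.queried y)),
      hnn (k < (hitColumns (touched cell d (t.queried y)) a).card)]
  by_cases h2 : (false, u b, b) ∈ touched cell d (t.queried y)
  · rw [if_pos h2]
    linarith [hnn (t.eval y = true),
      hnn ((false, v, b) ∈ touched cell d (t.queried y)),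
      hnn (k < (hitColumns (touched cell d (t.queried y)) a).card)]
  by_cases h3 : (false, v, b) ∈ touched cell d (t.queried y)
  · rw [if_pos h3]
    linarith [hnn (t.eval y = true),
      hnn ((false, u b, b) ∈ touched cell d (t.queried y)),
      hnn (k < (hitColumns (touched cell d (t.queried y)) a).card)]
  by_cases h4 : k < (hitColumns (touched cell d (t.queried y)) a).card
  · rw [if_pos h4]
    linarith [hnn (t.eval y = true),
      hnn ((false, u b, b) ∈ touched cell d (t.queried y)),
      hnn ((false, v, b) ∈ touched cell d (t.queried y))]
  · rw [if_neg h1, if_neg h2, if_neg h3, if_neg h4]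
    have h5 : t.eval y = false ∧ (false, u b, b) ∉ touched cell d (t.queried y) ∧
        (false, v, b) ∉ touched cell d (t.queried y) := ⟨Bool.eq_false_of_not_eq_true h1, h2, h3⟩
    simp only [h5, not_false_eq_true, and_self, true_and]
    linarith [hJ _ (not_lt.1 h4)]

theorem one_le_error_add_touched (hn : 0 < n) (hs : Hides cell sym d) (hd : 0 < d)
    (hJ : ∀ K : Finset (Fin n), K.card ≤ k →
      1 ≤ D * 𝔼 θ, if Disjoint (J θ) K then (1 : ℝ) else 0) (hD : 0 ≤ D)
    (t : DecisionTree ι Bool) :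
    1 ≤ (𝔼 ω : (Fin n → Fin n) × Fin n × Fin n,
        eventProb sym t (fun c => enc (extraZero ω.1 ω.2.1 ω.2.2 c)) (fun o _ => o = true))
      + 2 / n ^ 2 * (𝔼 u : Fin n → Fin n, expectedTouched cell sym d t (fun c => enc (zeros u c)))
      + 1 / (n * (k + 1)) * (𝔼 ω : (Fin n → Fin n) × Fin n × Fin n,
          expectedTouched cell sym d t (fun c => enc (extraZero ω.1 ω.2.1 ω.2.2 c)))
      + D * 𝔼 ω : (Fin n → Fin n) × Fin n × Fin n, 𝔼 a : Fin n, 𝔼 θ,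
          eventProb sym t (fun c => enc (certified ω.1 ω.2.2 a (J θ) c)) (fun o _ => o = false) := by
  have hne : Nonempty (Fin n) := ⟨⟨0, hn⟩⟩
  have h1 : (1 : ℝ) ≤ 𝔼 ω : (Fin n → Fin n) × Fin n × Fin n, 𝔼 a : Fin n,
      (eventProb sym t (fun c => enc (extraZero ω.1 ω.2.1 ω.2.2 c)) (fun o _ => o = true)
      + eventProb sym t (fun c => enc (extraZero ω.1 ω.2.1 ω.2.2 c))
          (fun _ Q => (false, ω.1 ω.2.2, ω.2.2) ∈ touched cell d Q)
      + eventProb sym t (fun c => enc (extraZero ω.1 ω.2.1 ω.2.2 c))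
          (fun _ Q => (false, ω.2.1, ω.2.2) ∈ touched cell d Q)
      + eventProb sym t (fun c => enc (extraZero ω.1 ω.2.1 ω.2.2 c))
          (fun _ Q => k < (hitColumns (touched cell d Q) a).card)
      + D * 𝔼 θ, eventProb sym t (fun c => enc (certified ω.1 ω.2.2 a (J θ) c))
          (fun o _ => o = false)) :=
    Finset.le_expect Finset.univ_nonempty fun ω _ => Finset.le_expect Finset.univ_nonempty
      fun a _ => one_le_eventProb_add enc J hs hd hJ hD t ω.1 ω.2.1 ω.2.2 a
  simp only [Finset.expect_add_distrib, Fintype.expect_const, ← Finset.mul_expect] at h1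
  have h2 := hs.expect_extraZero_touched_le enc hd t
  have h3 := hs.expect_extraZero_touched_le' enc hd t
  have h4 : (𝔼 ω : (Fin n → Fin n) × Fin n × Fin n, 𝔼 a : Fin n,
      eventProb sym t (fun c => enc (extraZero ω.1 ω.2.1 ω.2.2 c))
        (fun _ Q => k < (hitColumns (touched cell d Q) a).card)) ≤ _ :=
    Finset.expect_le_expect fun ω _ => expect_eventProb_hitColumns_le k t _
  rw [← Finset.expect_div] at h2 h3 h4
  rw [div_eq_mul_one_div, mul_comm] at h4
  rw [div_eq_inv_mul] at h2 h3
  rw [div_eq_mul_inv]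
  linarith

end SingleTree

/-! ### The lower bound for randomized algorithms -/

section Averaging

set_option linter.unusedSectionVars false

open scoped BigOperators

variable {n : ℕ} {ι V : Type} [Fintype ι] [DecidableEq ι] [AddCommGroup V] [DecidableEq V]
  {cell : ι → Cell n} {sym : (ι → Bool) → Cell n → V} {d : ℕ}

theorem AverageLE.expectedTouched (hd : 0 < d) {A : RandomizedAlgorithm ι Bool} {q : ℝ}
    (hq : 0 ≤ q) (hA : A.averageCost ≤ ENNReal.ofReal q) (x : Cell n → V) :
    AverageLE A (fun t => expectedTouched cell sym d t x) (q / d) := by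
  refine AverageLE.expect (fun y _ => ?_) (by positivity)
  rw [div_eq_inv_mul]
  refine ((AverageLE.card_queried hA y).const_mul (c := (d : ℝ)⁻¹) (by positivity)).mono
    fun t => ?_
  rw [← div_eq_inv_mul, le_div_iff₀ (by exact_mod_cast hd), mul_comm]
  exact_mod_cast mul_card_touched_le cell d (t.queried y)

theorem AverageLE.eventProb {A : RandomizedAlgorithm ι Bool} {f : (ι → Bool) → Bool} {ε : ℝ}
    (hε : 0 ≤ ε) (hA : A.Computes f ε) {x : Cell n → V} {o : Bool}
    (hf : ∀ y, sym y = x → f y = !o) :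
    AverageLE A (fun t => eventProb sym t x fun o' _ => o' = o) ε := by
  refine AverageLE.expect (fun y hy => ?_) hε
  have h := AverageLE.error hA y
  rw [hf y (mem_encodings.1 hy), Bool.not_not] at h
  exact h

theorem one_le_of_computes (hn : 0 < n) (hs : Hides cell sym d) (hd : 0 < d)
    {enc : Entry n → V} {dec : V → Entry n} (hdec : ∀ e, dec (enc e) = e)
    {f : (ι → Bool) → Bool} (hf : ∀ y, f y = true ↔ Accepts fun c => dec (sym y c))
    {Θ : Type} [Fintype Θ] (J : Θ → Finset (Fin n)) {k : ℕ} {D : ℝ}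
    (hJ2 : ∀ θ, 2 * n ≤ 3 * (J θ).card)
    (hJ : ∀ K : Finset (Fin n), K.card ≤ k →
      1 ≤ D * 𝔼 θ, if Disjoint (J θ) K then (1 : ℝ) else 0) (hD : 0 ≤ D)
    {A : RandomizedAlgorithm ι Bool} {ε q : ℝ} (hε : 0 ≤ ε) (hq : 0 ≤ q)
    (hA : A.Computes f ε) (hAq : A.averageCost ≤ ENNReal.ofReal q) :
    1 ≤ ε + 2 / n ^ 2 * (q / d) + 1 / (n * (k + 1)) * (q / d) + D * ε := by
  refine AverageLE.one_le (A := A) ?_ (one_le_error_add_touched enc J hn hs hd hJ hD)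
  refine AverageLE.add (AverageLE.add (AverageLE.add ?_ ?_ ?_ ?_) ?_ ?_ ?_) ?_ ?_ ?_
  · refine AverageLE.expect (fun ω _ => AverageLE.eventProb hε hA fun y hy => ?_) hε
    rw [Bool.not_true, ← Bool.not_eq_true, hf, hy]
    simp only [hdec]
    exact not_accepts_extraZero _ _ _
  · exact (AverageLE.expect (fun u _ => AverageLE.expectedTouched hd hq hAq _)
      (by positivity)).const_mul (by positivity)
  · exact hε
  · positivity
  · exact (AverageLE.expect (fun u _ => AverageLE.expectedTouched hd hq hAq _)
      (by positivity)).const_mul (by positivity)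
  · positivity
  · positivity
  · refine AverageLE.const_mul (AverageLE.expect (fun ω _ => AverageLE.expect (fun a _ =>
      AverageLE.expect (fun θ _ => AverageLE.eventProb hε hA fun y hy => ?_) hε) hε) hε) hD
    rw [Bool.not_false, hf, hy]
    simp only [hdec]
    exact accepts_certified _ _ _ (hJ2 θ)
  · positivity
  · positivity

end Averaging

/-! ### Random sets that avoid a small set -/

section Avoiding

open scoped BigOperators

variable {n : ℕ}

theorem card_colorings_zero_on (K : Finset (Fin n)) :
    (Finset.univ.filter fun κ : Fin n → Fin 4 => ∀ j ∈ K, κ j = 0).card = 4 ^ (n - K.card) := by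
  have h : (Finset.univ.filter fun κ : Fin n → Fin 4 => ∀ j ∈ K, κ j = 0) =
      Fintype.piFinset fun j => if j ∈ K then {0} else Finset.univ := by
    ext κ
    simp only [Finset.mem_filter, Finset.mem_univ, true_and, Fintype.mem_piFinset]
    refine forall_congr' fun j => ?_
    by_cases hj : j ∈ K <;> simp [hj]
  rw [h, Fintype.card_piFinset]
  have h2 : ∀ j, (if j ∈ K then ({0} : Finset (Fin 4)) else Finset.univ).card =
      if j ∈ K then 1 else 4 := by
    intro j
    split_ifs <;> simp
  simp only [h2]
  rw [Finset.prod_ite]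
  simp only [Finset.prod_const, one_pow, one_mul]
  congr 1
  have := Finset.card_filter_add_card_filter_not (s := (Finset.univ : Finset (Fin n))) (· ∈ K)
  simp only [Finset.filter_univ_mem, Finset.card_univ, Fintype.card_fin] at this
  omega

theorem four_pow_le_seven_mul_card {k : ℕ} (hk : 24 * k ≤ n) (K : Finset (Fin n))
    (hK : K.card ≤ k) :
    4 ^ (n - K.card) ≤ 7 * (Finset.univ.filter fun κ : Fin n → Fin 4 =>
      (∀ j ∈ K, κ j = 0) ∧ 3 * (Finset.univ.filter fun j => κ j = 0).card ≤ n).card := by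
  set Z := Finset.univ.filter fun κ : Fin n → Fin 4 => ∀ j ∈ K, κ j = 0 with hZ
  have hZc : Z.card = 4 ^ (n - K.card) := card_colorings_zero_on K
  rcases Nat.eq_zero_or_pos n with rfl | hn
  · have : K = ∅ := Finset.eq_empty_of_isEmpty K
    subst this
    simp
  have hsplit := Finset.card_filter_add_card_filter_not (s := Z)
    fun κ => 3 * (Finset.univ.filter fun j => κ j = 0).card ≤ n
  have hgood : (Z.filter fun κ => 3 * (Finset.univ.filter fun j => κ j = 0).card ≤ n) =
      Finset.univ.filter fun κ : Fin n → Fin 4 =>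
        (∀ j ∈ K, κ j = 0) ∧ 3 * (Finset.univ.filter fun j => κ j = 0).card ≤ n := by
    rw [hZ, Finset.filter_filter]
  rw [hgood] at hsplit
  set bad := Z.filter fun κ => ¬ 3 * (Finset.univ.filter fun j => κ j = 0).card ≤ n with hbad
  have hzeros : ∀ κ ∈ bad, 7 * n ≤ 24 * (Kᶜ.filter fun j => κ j = 0).card := by
    intro κ hκ
    have h1 := (Finset.mem_filter.1 hκ).2
    have h2 : (Finset.univ.filter fun j => κ j = 0).card ≤
        K.card + (Kᶜ.filter fun j => κ j = 0).card := by
      refine (Finset.card_le_card fun j hj => ?_).trans (Finset.card_union_le _ _)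
      by_cases hjK : j ∈ K <;> simp_all
    omega
  have hsum : 4 * ∑ κ ∈ Z, (Kᶜ.filter fun j => κ j = 0).card ≤ n * 4 ^ (n - K.card) := by
    simp only [Finset.card_filter]
    rw [Finset.sum_comm, Finset.mul_sum]
    have hterm : ∀ j ∈ Kᶜ, 4 * ∑ κ ∈ Z, (if κ j = 0 then 1 else 0) ≤ 4 ^ (n - K.card) := by
      intro j hj
      have hj' : j ∉ K := Finset.mem_compl.1 hj
      have hlt : K.card < n := by
        have := Finset.card_lt_univ_of_notMem hj'
        simpa using this
      rw [← Finset.card_filter, hZ, Finset.filter_filter]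
      have hins : (Finset.univ.filter fun κ : Fin n → Fin 4 => (∀ i ∈ K, κ i = 0) ∧ κ j = 0) =
          Finset.univ.filter fun κ : Fin n → Fin 4 => ∀ i ∈ insert j K, κ i = 0 := by
        ext κ
        simp [and_comm]
      rw [hins, card_colorings_zero_on, Finset.card_insert_of_notMem hj', ← pow_succ']
      exact Nat.pow_le_pow_right (by norm_num) (by omega)
    refine (Finset.sum_le_card_nsmul _ _ _ hterm).trans ?_
    rw [smul_eq_mul]
    refine Nat.mul_le_mul_right _ ((Finset.card_le_univ _).trans_eq ?_)
    simp
  have hbad7 : bad.card * (7 * n) ≤ 6 * (n * 4 ^ (n - K.card)) := by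
    have h1 := Finset.card_nsmul_le_sum bad (fun κ => 24 * (Kᶜ.filter fun j => κ j = 0).card)
      (7 * n) hzeros
    have h2 : ∑ κ ∈ bad, 24 * (Kᶜ.filter fun j => κ j = 0).card ≤
        ∑ κ ∈ Z, 24 * (Kᶜ.filter fun j => κ j = 0).card :=
      Finset.sum_le_sum_of_subset (Finset.filter_subset _ _)
    have h3 : ∑ κ ∈ Z, 24 * (Kᶜ.filter fun j => κ j = 0).card =
        24 * ∑ κ ∈ Z, (Kᶜ.filter fun j => κ j = 0).card := (Finset.mul_sum _ _ _).symm
    rw [smul_eq_mul] at h1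
    omega
  have hbad6 : 7 * bad.card ≤ 6 * 4 ^ (n - K.card) := by
    refine le_of_mul_le_mul_left (a := n) ?_ hn
    calc n * (7 * bad.card) = bad.card * (7 * n) := by ring
      _ ≤ 6 * (n * 4 ^ (n - K.card)) := hbad7
      _ = n * (6 * 4 ^ (n - K.card)) := by ring
  omega

/-- Colorings of `Fin n` by four colors in which at most a third of the points have color `0`. -/
abbrev FewZeroColoring (n : ℕ) : Type :=
  {κ : Fin n → Fin 4 // 3 * (Finset.univ.filter fun j => κ j = 0).card ≤ n}

theorem two_mul_le_card_ne_zero (κ : FewZeroColoring n) :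
    2 * n ≤ 3 * (Finset.univ.filter fun j => κ.1 j ≠ 0).card := by
  have h1 := κ.2
  have := Finset.card_filter_add_card_filter_not (s := (Finset.univ : Finset (Fin n)))
    (fun j => κ.1 j = 0)
  simp only [Finset.card_univ, Fintype.card_fin] at this
  simp only [ne_eq]
  omega

theorem one_le_mul_expect_disjoint {k : ℕ} (hk : 24 * k ≤ n) (K : Finset (Fin n))
    (hK : K.card ≤ k) :
    1 ≤ (7 * 4 ^ k : ℝ) * 𝔼 κ : FewZeroColoring n,
      if Disjoint (Finset.univ.filter fun j => κ.1 j ≠ 0) K then (1 : ℝ) else 0 := by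
  rw [Fintype.expect_eq_sum_div_card, Finset.sum_boole]
  have hcard : (Finset.univ.filter fun κ : FewZeroColoring n =>
      Disjoint (Finset.univ.filter fun j => κ.1 j ≠ 0) K).card =
      (Finset.univ.filter fun κ : Fin n → Fin 4 =>
      (∀ j ∈ K, κ j = 0) ∧ 3 * (Finset.univ.filter fun j => κ j = 0).card ≤ n).card := by
    refine Finset.card_bij (fun κ _ => κ.1) ?_ (fun κ _ κ' _ h => Subtype.ext h) ?_
    · intro κ hκ
      simp only [Finset.mem_filter, Finset.mem_univ, true_and] at hκ ⊢
      refine ⟨fun j hj => ?_, κ.2⟩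
      by_contra h
      exact Finset.disjoint_left.1 hκ (by simpa using h) hj
    · intro κ hκ
      simp only [Finset.mem_filter, Finset.mem_univ, true_and] at hκ
      refine ⟨⟨κ, hκ.2⟩, ?_, rfl⟩
      simp only [Finset.mem_filter, Finset.mem_univ, true_and]
      rw [Finset.disjoint_left]
      intro j hj hjK
      simp [hκ.1 j hjK] at hj
  have h7 := four_pow_le_seven_mul_card hk K hK
  rw [← hcard] at h7
  set g := (Finset.univ.filter fun κ : FewZeroColoring n =>
      Disjoint (Finset.univ.filter fun j => κ.1 j ≠ 0) K).card
  have hg : 0 < g := by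
    have : 0 < 4 ^ (n - K.card) := by positivity
    omega
  have hle : g ≤ Fintype.card (FewZeroColoring n) := Finset.card_le_univ _
  have hpos : (0 : ℝ) < Fintype.card (FewZeroColoring n) := by exact_mod_cast hg.trans_le hle
  have hΘ : Fintype.card (FewZeroColoring n) ≤ 4 ^ n := by
    refine (Fintype.card_subtype_le _).trans_eq ?_
    simp
  rw [mul_div_assoc', one_le_div hpos]
  have hKn : K.card ≤ n := by omega
  have : 4 ^ n ≤ 7 * 4 ^ k * g := by
    calc 4 ^ n = 4 ^ K.card * 4 ^ (n - K.card) := by rw [← pow_add]; congr 1; omega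
      _ ≤ 4 ^ k * (7 * g) := Nat.mul_le_mul (Nat.pow_le_pow_right (by norm_num) hK) h7
      _ = 7 * 4 ^ k * g := by ring
  exact_mod_cast hΘ.trans this

end Avoiding

/-! ### Encoding the cells by bits -/

theorem exists_encoding_entry {n w : ℕ}
    (hw : 2 + (n ^ n * n ^ n + n * n) ≤ 2 ^ w) :
    ∃ (enc : Entry n → Fin w → ZMod 2) (dec : (Fin w → ZMod 2) → Entry n),
      ∀ e, dec (enc e) = e := by
  have hn' : Nonempty (Entry n) := ⟨.zero⟩
  obtain ⟨g⟩ : Nonempty ((Bool ⊕ ((Fin n → Fin n) × (Fin n → Fin n)) ⊕ (Fin n × Fin n)) ↪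
      (Fin w → ZMod 2)) := by
    refine Function.Embedding.nonempty_of_card_le ?_
    simpa using hw
  let h : Entry n → Bool ⊕ ((Fin n → Fin n) × (Fin n → Fin n)) ⊕ (Fin n × Fin n)
    | .zero => .inl false
    | .one => .inl true
    | .cert r s => .inr (.inl (r, s))
    | .ptr i b => .inr (.inr (i, b))
  have hh : Function.Injective h := by
    intro e e' hee
    cases e <;> cases e' <;> simp_all [h]
  exact ⟨fun e => g (h e), Function.invFun fun e => g (h e),
    Function.leftInverse_invFun (g.injective.comp hh)⟩

section BlockEncoding

variable {ι C : Type} {B w : ℕ}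

/-- The contents of the cells encoded by a bit string that is cut into blocks by `e`. -/
def blockSyndrome (e : ι ≃ C × Fin B) (H : Fin B → Fin w → ZMod 2) (y : ι → Bool) (c : C) :
    Fin w → ZMod 2 :=
  syndrome H fun k => y (e.symm (c, k))

theorem hides_blockSyndrome [DecidableEq ι] [Fintype C] [DecidableEq C] (e : ι ≃ C × Fin B)
    {H : Fin B → Fin w → ZMod 2} {d : ℕ}
    (hH : ∀ S : Finset (Fin B), S.card < d →
      ∀ s, ∃ z : Fin B → Bool, (∀ k ∈ S, z k = false) ∧ syndrome H z = s) :
    Hides (fun i => (e i).1) (blockSyndrome e H) d := by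
  intro Q g hg
  have hblock : ∀ c, ∃ z : Fin B → Bool,
      (∀ k, e.symm (c, k) ∈ Q → z k = false) ∧ syndrome H z = g c := by
    intro c
    by_cases hc : c ∈ touched (fun i => (e i).1) d Q
    · exact ⟨fun _ => false, fun _ _ => rfl, by simp [hg c hc, syndrome]⟩
    · obtain ⟨z, hz, hzs⟩ := hH (Finset.univ.filter fun k => e.symm (c, k) ∈ Q) (by
        simp only [touched, Finset.mem_filter, Finset.mem_univ, true_and, not_le] at hc
        refine lt_of_le_of_lt (Finset.card_le_card_of_injOn (fun k => e.symm (c, k)) ?_ ?_) hc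
        · intro k hk
          simpa using hk
        · intro k _ k' _ h
          simpa using h) (g c)
      exact ⟨z, fun k hk => hz k (by simpa using hk), hzs⟩
  choose z hz hzs using hblock
  refine ⟨fun i => z (e i).1 (e i).2, fun i hi => hz _ _ (by simpa using hi), fun y => ?_⟩
  funext c
  rw [Pi.add_apply, ← hzs c, blockSyndrome, blockSyndrome, ← syndrome_xor]
  simp

theorem implementable_blockSyndrome (e : ι ≃ C × Fin B) (H : Fin B → Fin w → ZMod 2) (c : C) :
    Implementable (fun y => blockSyndrome e H y c) B := by
  have h := Implementable.pi fun k : Fin B =>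
    Implementable.coord (X := Bool) (e.symm (c, k))
  rw [mul_one] at h
  exact h.map (syndrome H)

end BlockEncoding

/-! ### Choice of the parameters -/

/-- The arithmetic that turns the lower bounds for the two families of hard inputs into a bound
proportional to `log₂ (1 / ε)`. -/
theorem mul_logb_le_of_bounds {n w : ℕ} (hn : 0 < n) (hw : 0 < w) {ε q : ℝ} (hε : 0 < ε)
    (hε3 : ε ≤ 1 / 3) (hq : 0 ≤ q) (hL : Real.logb 2 (1 / ε) < 6 * n)
    (hbase : 1 ≤ ε + 2 / n ^ 2 * (q / w) + 1 / (n * (((0 : ℕ) : ℝ) + 1)) * (q / w) + 1 * ε)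
    (hk : ∀ k : ℕ, 24 * k ≤ n →
      1 ≤ ε + 2 / n ^ 2 * (q / w) + 1 / (n * (k + 1)) * (q / w) + 7 * 4 ^ k * ε) :
    (n * w : ℝ) * Real.logb 2 (1 / ε) ≤ 624 * q := by
  set L := Real.logb 2 (1 / ε) with hLdef
  have hn0 : (0 : ℝ) < n := by exact_mod_cast hn
  have hn1 : (1 : ℝ) ≤ n := by exact_mod_cast hn
  have hw0 : (0 : ℝ) < w := by exact_mod_cast hw
  set p := q / (n * w) with hp
  have hp0 : 0 ≤ p := by positivity
  have hqp : q = p * (n * w) := by rw [hp]; field_simp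
  have hsq : 2 / (n : ℝ) ^ 2 * (q / w) = 2 / n * p := by rw [hp]; field_simp
  have hlin : ∀ k : ℝ, 0 ≤ k → 1 / ((n : ℝ) * (k + 1)) * (q / w) = 1 / (k + 1) * p := by
    intro k hk
    rw [hp]
    field_simp
  suffices hmain : L ≤ 624 * p by
    rw [hqp]
    calc (n * w : ℝ) * L ≤ (n * w : ℝ) * (624 * p) := by gcongr
      _ = _ := by ring
  rcases le_or_gt L 32 with hL32 | hL32
  · rw [hsq, hlin _ (by simp)] at hbase
    have h1 : 2 / (n : ℝ) * p ≤ 2 * p :=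
      mul_le_mul_of_nonneg_right (div_le_self (by norm_num) hn1) hp0
    norm_num at hbase
    linarith
  · have hL0 : 0 < L := by linarith
    set k := ⌊L / 144⌋₊ with hkdef
    have hk1 : (k : ℝ) ≤ L / 144 := Nat.floor_le (by positivity)
    have hk2 : L / 144 < k + 1 := Nat.lt_floor_add_one _
    have hkn : 24 * k ≤ n := by
      have : (24 * k : ℝ) ≤ n := by linarith
      exact_mod_cast this
    have h := hk k hkn
    rw [hsq, hlin _ (by positivity)] at h
    have hεL : ε = (2 : ℝ) ^ (-L) := by
      rw [hLdef, one_div, Real.logb_inv, neg_neg, Real.rpow_logb (by norm_num) (by norm_num) hε]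
    have hDε : 7 * (4 : ℝ) ^ k * ε ≤ 1 / 2 := by
      have h4 : (4 : ℝ) ^ k = (2 : ℝ) ^ (2 * k : ℝ) := by
        rw [show (4 : ℝ) = 2 ^ (2 : ℝ) by norm_num, ← Real.rpow_natCast,
          ← Real.rpow_mul (by norm_num)]
      have h8 : (7 : ℝ) ≤ (2 : ℝ) ^ (3 : ℝ) := by norm_num
      calc 7 * (4 : ℝ) ^ k * ε ≤ (2 : ℝ) ^ (3 : ℝ) * (2 : ℝ) ^ (2 * k : ℝ) * (2 : ℝ) ^ (-L) := by
            rw [← h4, ← hεL]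
            gcongr
        _ = (2 : ℝ) ^ (3 + 2 * k + -L : ℝ) := by
            rw [← Real.rpow_add (by norm_num), ← Real.rpow_add (by norm_num)]
        _ ≤ (2 : ℝ) ^ (-1 : ℝ) := Real.rpow_le_rpow_of_exponent_le (by norm_num) (by linarith)
        _ = 1 / 2 := by rw [Real.rpow_neg_one]; norm_num
    have hε4 : ε ≤ 1 / 4 := by
      rw [hεL]
      calc (2 : ℝ) ^ (-L) ≤ (2 : ℝ) ^ (-2 : ℝ) :=
            Real.rpow_le_rpow_of_exponent_le (by norm_num) (by linarith)
        _ = 1 / 4 := by rw [Real.rpow_neg (by norm_num)]; norm_num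
    have h12 : 2 / (n : ℝ) ≤ 12 / L := by
      rw [div_le_div_iff₀ hn0 hL0]
      linarith
    have h144 : 1 / ((k : ℝ) + 1) ≤ 144 / L := by
      rw [div_le_div_iff₀ (by positivity) hL0]
      linarith
    have h5 : 1 / 4 ≤ 156 / L * p := by
      have h6 := mul_le_mul_of_nonneg_right h12 hp0
      have h7 := mul_le_mul_of_nonneg_right h144 hp0
      have h8 : 156 / L * p = 12 / L * p + 144 / L * p := by ring
      linarith
    rw [div_mul_eq_mul_div, le_div_iff₀ hL0] at h5
    linarith

theorem rpow_third_le {a n N : ℕ} (ha : 0 < a) (hn : n = 2 ^ a)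
    (hN : N = 32 * n ^ 2 * (2 * n * a + 2)) :
    ((N : ℝ) / Real.logb 2 N) ^ (1 / 3 : ℝ) ≤ 6 * n := by
  have hn1 : 1 ≤ n := by rw [hn]; exact Nat.one_le_two_pow
  have ha0 : (0 : ℝ) < a := by exact_mod_cast ha
  have hnN : n ≤ N := by
    rw [hN]
    nlinarith [Nat.mul_le_mul hn1 hn1, Nat.zero_le (n ^ 2 * (2 * n * a))]
  have hlog : (a : ℝ) ≤ Real.logb 2 N := by
    rw [Real.le_logb_iff_rpow_le (by norm_num) (by exact_mod_cast hn1.trans hnN),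
      Real.rpow_natCast]
    exact_mod_cast hn ▸ hnN
  have hNle : (N : ℝ) ≤ 128 * n ^ 3 * a := by
    have h1 : 2 ≤ 2 * n * a := by nlinarith [Nat.mul_le_mul hn1 ha]
    have h2 : N ≤ 128 * n ^ 3 * a := by
      calc N = 32 * n ^ 2 * (2 * n * a + 2) := hN
        _ ≤ 32 * n ^ 2 * (2 * n * a + 2 * n * a) := by gcongr
        _ = 128 * n ^ 3 * a := by ring
    exact_mod_cast h2
  have hdiv : (N : ℝ) / Real.logb 2 N ≤ (6 * n) ^ (3 : ℝ) := by
    rw [div_le_iff₀ (ha0.trans_le hlog)]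
    have h3 : ((6 * n : ℝ)) ^ (3 : ℝ) = 216 * n ^ 3 := by
      rw [show (3 : ℝ) = ((3 : ℕ) : ℝ) by norm_num, Real.rpow_natCast]
      ring
    rw [h3]
    calc (N : ℝ) ≤ 128 * n ^ 3 * a := hNle
      _ ≤ 216 * n ^ 3 * Real.logb 2 N := by gcongr; norm_num
  calc ((N : ℝ) / Real.logb 2 N) ^ (1 / 3 : ℝ) ≤ ((6 * n : ℝ) ^ (3 : ℝ)) ^ (1 / 3 : ℝ) :=
        Real.rpow_le_rpow (div_nonneg (by positivity) (ha0.le.trans hlog)) hdiv (by norm_num)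
    _ = 6 * n := by
        rw [← Real.rpow_mul (by positivity)]
        norm_num

theorem entry_count_le {a n : ℕ} (hn : n = 2 ^ a) :
    2 + (n ^ n * n ^ n + n * n) ≤ 2 ^ (2 * n * a + 2) := by
  have hn1 : 1 ≤ n := by rw [hn]; exact Nat.one_le_two_pow
  have h1 : n ^ n * n ^ n = 2 ^ (2 * n * a) := by
    rw [← pow_add]
    nth_rewrite 1 [hn]
    rw [← pow_mul]
    congr 1
    ring
  have h2 : n * n ≤ n ^ n * n ^ n :=
    Nat.mul_le_mul (Nat.le_self_pow (by omega) n) (Nat.le_self_pow (by omega) n)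
  have h3 : 1 ≤ n ^ n * n ^ n := Nat.mul_pos (by positivity) (by positivity)
  rw [pow_add, ← h1]
  omega

theorem exists_hard_function {a : ℕ} (ha : 0 < a) :
    ∃ N : ℕ, 2 ^ a ≤ N ∧ ∃ f : (Fin N → Bool) → Bool,
      (∃ x y, f x ≠ f y) ∧
      ∀ ε : ℝ, (2 : ℝ) ^ (-(((N : ℝ) / Real.logb 2 N) ^ (1 / 3 : ℝ))) < ε → ε ≤ 1 / 3 →
        ENNReal.ofReal (1 / 59904) * randomizedQueryComplexity (1 / 3) f
            * ENNReal.ofReal (Real.logb 2 (1 / ε))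
          ≤ averageQueryComplexity ε f := by
  classical
  obtain ⟨n, hn⟩ : ∃ n, n = 2 ^ a := ⟨_, rfl⟩
  obtain ⟨w, hw⟩ : ∃ w, w = 2 * n * a + 2 := ⟨_, rfl⟩
  obtain ⟨N, hN⟩ : ∃ N, N = 32 * n ^ 2 * w := ⟨_, rfl⟩
  have hn0 : 0 < n := by rw [hn]; positivity
  have hw0 : 0 < w := by omega
  have hnN : n ≤ N := by
    rw [hN]
    nlinarith [Nat.mul_le_mul hn0 hn0, Nat.mul_le_mul (Nat.mul_le_mul hn0 hn0) hw0]
  obtain ⟨H, hH⟩ := exists_code_syndrome_surjective hw0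
  obtain ⟨enc, dec, hdec⟩ := exists_encoding_entry (hw ▸ entry_count_le hn)
  obtain ⟨e⟩ : Nonempty (Fin N ≃ Cell n × Fin (16 * w)) := by
    refine Fintype.card_eq.1 ?_
    simp only [Fintype.card_fin, Fintype.card_prod, Fintype.card_bool]
    rw [hN]
    ring
  have hs := hides_blockSyndrome e hH
  set sym := blockSyndrome e H
  set f : (Fin N → Bool) → Bool := fun y => decide (Accepts fun c => dec (sym y c))
  have hfiff : ∀ y, f y = true ↔ Accepts fun c => dec (sym y c) := fun y => decide_eq_true_iff
  refine ⟨N, hn ▸ hnN, f, ?_, fun ε hε hε3 => ?_⟩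
  · have b : Fin n := ⟨0, hn0⟩
    obtain ⟨y, hy⟩ := hs.encodings_nonempty hw0 fun c => enc (extraZero (fun _ => b) b b c)
    obtain ⟨y', hy'⟩ := hs.encodings_nonempty hw0
      fun c => enc (certified (fun _ => b) b b Finset.univ c)
    refine ⟨y, y', fun h => ?_⟩
    have h1 : f y' = true := by
      rw [hfiff, mem_encodings.1 hy']
      simp only [hdec]
      exact accepts_certified _ _ _ (by simp; omega)
    rw [← h, hfiff, mem_encodings.1 hy] at h1
    simp only [hdec] at h1
    exact not_accepts_extraZero _ _ _ h1
  · have hε0 : 0 < ε := lt_trans (by positivity) hε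
    have hL : Real.logb 2 (1 / ε) < 6 * n := by
      have h1 := rpow_third_le ha hn (hw ▸ hN)
      have h2 := (Real.lt_logb_iff_rpow_lt (by norm_num) hε0).2 hε
      rw [one_div, Real.logb_inv]
      linarith
    have hR : randomizedQueryComplexity (1 / 3) f ≤ ENNReal.ofReal (96 * (n * w)) := by
      have h1 := randomizedQueryComplexity_accepts_le (x := fun y c => dec (sym y c)) hn0
        fun c => (implementable_blockSyndrome e H c).map dec
      refine (le_of_eq ?_).trans (h1.trans (le_of_eq ?_))
      · congr!
      · rw [← ENNReal.ofReal_natCast]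
        congr 1
        push_cast
        ring
    refine le_iInf₂ fun A hA => ?_
    rcases eq_or_ne A.averageCost ∞ with htop | htop
    · rw [htop]
      exact le_top
    obtain ⟨q, hq0, hq⟩ : ∃ q : ℝ, 0 ≤ q ∧ A.averageCost = ENNReal.ofReal q :=
      ⟨_, ENNReal.toReal_nonneg, (ENNReal.ofReal_toReal htop).symm⟩
    have hbase := one_le_of_computes hn0 hs hw0 hdec hfiff (k := 0) (D := 1)
      (fun _ : Unit => Finset.univ) (fun _ => by simp; omega)
      (fun K hK => by simp [Finset.card_eq_zero.1 (Nat.le_zero.1 hK)]) zero_le_one hε0.le hq0 hA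
      hq.le
    have hmain := mul_logb_le_of_bounds hn0 hw0 hε0 hε3 hq0 hL hbase fun k hk =>
      one_le_of_computes hn0 hs hw0 hdec hfiff (k := k) (D := 7 * 4 ^ k)
        (fun κ : FewZeroColoring n => Finset.univ.filter fun j => κ.1 j ≠ 0)
        two_mul_le_card_ne_zero (fun K hK => one_le_mul_expect_disjoint hk K hK) (by positivity)
        hε0.le hq0 hA hq.le
    rw [hq]
    calc _ ≤ ENNReal.ofReal (1 / 59904) * ENNReal.ofReal (96 * (n * w))
          * ENNReal.ofReal (Real.logb 2 (1 / ε)) := by gcongr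
      _ = ENNReal.ofReal (1 / 59904 * (96 * (n * w)) * Real.logb 2 (1 / ε)) := by
          rw [ENNReal.ofReal_mul (p := 1 / 59904 * (96 * (n * w))) (by positivity),
            ENNReal.ofReal_mul (p := 1 / 59904) (by positivity)]
      _ ≤ ENNReal.ofReal q := ENNReal.ofReal_le_ofReal (by linarith)

theorem theorem1 :
    ∃ c : ℝ, 0 < c ∧
      {n : ℕ | ∃ f : (Fin n → Bool) → Bool,
        (∃ x y, f x ≠ f y) ∧
        ∀ ε : ℝ, (2 : ℝ) ^ (-(((n : ℝ) / Real.logb 2 n) ^ (1 / 3 : ℝ))) < ε → ε ≤ 1 / 3 →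
          ENNReal.ofReal c * randomizedQueryComplexity (1 / 3) f
              * ENNReal.ofReal (Real.logb 2 (1 / ε))
            ≤ averageQueryComplexity ε f}.Infinite := by
  refine ⟨1 / 59904, by norm_num, Set.infinite_of_forall_exists_gt fun m => ?_⟩
  obtain ⟨N, hN, h⟩ := exists_hard_function (Nat.succ_pos m)
  exact ⟨N, h, ((Nat.lt_succ_self m).trans Nat.lt_two_pow_self).trans_le hN⟩
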